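/- Let $d\ge 2$ and let $A\in\mathbb R^{d\times d}$ be a symmetric positive definite matrix. Let $$\omega_d=\frac{2\pi^{d/2}}{\Gamma(d/2)},$$ which is the surface area of the unit sphere in $\mathbb R^d$. For $\xi,\eta\in\mathbb R^d$ with $\xi\ne\eta$ put $$G_A(\xi,\eta)=\begin{cases}\dfrac{1}{2\pi\sqrt{\det A}}\,\log\sqrt{(\xi-\eta)^{\top}A^{-1}(\xi-\eta)}, & d=2,\\[2mm] -\dfrac{1}{(d-2)\,\omega_d\sqrt{\det A}}\,\big[(\xi-\eta)^{\top}A^{-1}(\xi-\eta)\big]^{\frac{2-d}{2}}, & d\ge 3.\end{cases}$$ Then $G_A$ is a fundamental solution of the anisotropic Laplacian: for every $\eta\in\mathbb R^d$ the function $\xi\mapsto G_A(\xi,\eta)$ is locally integrable on $\mathbb R^d$, and $$\nabla_\xi\cdot\big(A\,\nabla_\xi G_A(\xi,\eta)\big)=\delta(\xi-\eta)$$ in the sense of distributions on $\mathbb R^d$, where $\delta(\xi-\eta)$ is the Dirac delta distribution at $\eta$; that is, $\int_{\mathbb R^d}G_A(\xi,\eta)\,\nabla\cdot(A\nabla\varphi)(\xi)\,d\xi=\varphi(\eta)$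 for every $\varphi\in C_c^\infty(\mathbb R^d)$. -/

import Mathlib

open MeasureTheory
open scoped Distributions LineDeriv Matrix

noncomputable section

/-- The surface area `ω_d` of the unit sphere of the Euclidean space `ℝ^d`: the total mass of the
surface measure that Lebesgue measure induces on the unit sphere (polar coordinates). -/
def unitSphereArea (d : ℕ) : ℝ :=
  (volume : Measure (EuclideanSpace ℝ (Fin d))).toSphere.real Set.univ

/-- The quadratic form `vᵀ A⁻¹ v`. -/
def invQuadForm {d : ℕ} (A : Matrix (Fin d) (Fin d) ℝ) (v : EuclideanSpace ℝ (Fin d)) : ℝ :=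
  v.ofLp ⬝ᵥ (A⁻¹ *ᵥ v.ofLp)

/-- The function `G_A(ξ, η)`, given by the logarithmic formula for `d = 2` and by the power formula
in the other dimensions (which are `d ≥ 3` wherever it is used). -/
def anisotropicGreen {d : ℕ} (A : Matrix (Fin d) (Fin d) ℝ) (ξ η : EuclideanSpace ℝ (Fin d)) : ℝ :=
  if d = 2 then
    1 / (2 * Real.pi * √A.det) * Real.log (√(invQuadForm A (ξ - η)))
  else
    -(1 / (((d : ℝ) - 2) * unitSphereArea d * √A.det)) *
      invQuadForm A (ξ - η) ^ ((2 - (d : ℝ)) / 2)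

/-- The regular distribution `φ ↦ ∫ φ(ξ) f(ξ) dξ` on `ℝ^d` defined by a locally integrable
function `f`. -/
def regularDistribution {d : ℕ} (f : EuclideanSpace ℝ (Fin d) → ℝ) :
    𝓓'((⊤ : TopologicalSpace.Opens (EuclideanSpace ℝ (Fin d))), ℝ) :=
  TestFunction.integralAgainstBilinCLM (ContinuousLinearMap.mul ℝ ℝ) volume f

/-- The anisotropic Laplacian `∇·(A∇T) = ∑ᵢ ∂ᵢ (∑ⱼ Aᵢⱼ ∂ⱼ T)` of a distribution `T` on `ℝ^d`. -/
def anisotropicLaplacian {d : ℕ} (A : Matrix (Fin d) (Fin d) ℝ)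
    (T : 𝓓'((⊤ : TopologicalSpace.Opens (EuclideanSpace ℝ (Fin d))), ℝ)) :
    𝓓'((⊤ : TopologicalSpace.Opens (EuclideanSpace ℝ (Fin d))), ℝ) :=
  ∑ i : Fin d, ∂_{EuclideanSpace.single i (1 : ℝ)}
    (∑ j : Fin d, A i j • ∂_{EuclideanSpace.single j (1 : ℝ)} T)

end

/-! Write `q(ξ)` for the quadratic form of `ξ - η`. Up to the factor `1 / (ω_d √det A)`, the Green
function is `g(q)`, where `g = greenProfile d` satisfies `g'(t) = t ^ (-d/2) / 2` in every
dimension. Since `A∇q = 2(ξ - η)`, a single integration by parts formally turns `∫ g(q) ∇·(A∇φ)`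
into `-∫ q ^ (-d/2) Dφ(ξ)(ξ - η)`.

The last integral is explicit. A linear map `C` with `A = C Cᵀ` reduces it to `∫ ‖y‖ ^ (-d) Dψ(y)
y`. In polar coordinates the powers of the radius cancel, each ray contributes `-ψ 0`, and the
sphere contributes its area (`integral_radial_fderiv`).

To avoid boundary terms at the singularity, the integration by parts is done for `g(q + ε)`
(`integral_greenProfile_add_mul_divGrad`), and `ε → 0` by dominated convergence
(`integral_greenProfile_mul_divGrad`). -/

/-! ### The area of the sphere, and the radial identity in polar coordinates. -/

theorem unitSphereArea_eq {d : ℕ} (hd : 2 ≤ d) :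
    unitSphereArea d = 2 * Real.pi ^ ((d : ℝ) / 2) / Real.Gamma ((d : ℝ) / 2) := by
  have : Nonempty (Fin d) := ⟨⟨0, by omega⟩⟩
  have hd0 : (0 : ℝ) < d := by exact_mod_cast (by omega : 0 < d)
  have hG : 0 < Real.Gamma ((d : ℝ) / 2) := Real.Gamma_pos_of_pos (by positivity)
  rw [unitSphereArea, Measure.toSphere_real_apply_univ, measureReal_def,
    EuclideanSpace.volume_ball]
  simp only [finrank_euclideanSpace, Fintype.card_fin, ENNReal.ofReal_one, one_pow, one_mul]
  rw [ENNReal.toReal_ofReal (by positivity), Real.Gamma_add_one (by positivity),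
    Real.sqrt_eq_rpow, ← Real.rpow_natCast, ← Real.rpow_mul Real.pi_pos.le,
    show 1 / 2 * (d : ℝ) = d / 2 by ring]
  field_simp

theorem integral_Ioi_fderiv_smul {E : Type*} [NormedAddCommGroup E] [NormedSpace ℝ E]
    {ψ : E → ℝ} (hψ : ContDiff ℝ 1 ψ) (hc : HasCompactSupport ψ)
    {ω : E} (hω : ‖ω‖ = 1) : ∫ r in Set.Ioi (0 : ℝ), fderiv ℝ ψ (r • ω) ω = -ψ 0 := by
  have h1 : ContDiff ℝ 1 fun r : ℝ ↦ ψ (r • ω) :=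
    hψ.comp (contDiff_id.smul contDiff_const)
  obtain ⟨R, hR⟩ := hc.isCompact.isBounded.subset_closedBall 0
  have h2 : HasCompactSupport fun r : ℝ ↦ ψ (r • ω) := by
    refine HasCompactSupport.of_support_subset_isCompact (isCompact_closedBall (0 : ℝ) R)
      fun r hr ↦ ?_
    have := hR (subset_tsupport _ hr)
    simpa [norm_smul, hω] using this
  have h3 := HasCompactSupport.integral_Ioi_deriv_eq h1 h2 0
  simp only [zero_smul] at h3
  rw [← h3]
  congr 1
  funext r
  have hd : HasDerivAt (fun r : ℝ ↦ r • ω) ω r := by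
    simpa using (hasDerivAt_id r).smul_const ω
  exact ((hψ.differentiable one_ne_zero (r • ω)).hasFDerivAt.comp_hasDerivAt r hd).deriv.symm

section Radial

variable {E : Type*} [NormedAddCommGroup E] [NormedSpace ℝ E] [FiniteDimensional ℝ E]
  [Nontrivial E] [MeasurableSpace E] [BorelSpace E] (μ : Measure E) [μ.IsAddHaarMeasure]

/-- The derivative is bounded by some `M`, so the integrand is at most `M ‖y‖ ^ (1 - n)`, and the
polar Jacobian `r ^ (n - 1)` cancels this singularity exactly. -/
theorem integrable_radial_fderiv {ψ : E → ℝ} (hψ : ContDiff ℝ 1 ψ) (hc : HasCompactSupport ψ) :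
    Integrable (fun y ↦ (‖y‖ ^ Module.finrank ℝ E)⁻¹ * fderiv ℝ ψ y y) μ := by
  have hcont : Continuous (fderiv ℝ ψ) := hψ.continuous_fderiv one_ne_zero
  obtain ⟨M, hM⟩ := (hc.fderiv ℝ).exists_bound_of_continuous hcont
  obtain ⟨R, -, hR⟩ := (hc.fderiv ℝ).isCompact.isBounded.subset_ball_lt 0 0
  have hn : Module.finrank ℝ E ≠ 0 := Module.finrank_pos.ne'
  have hball : IntegrableOn (fun y : E ↦ M * (‖y‖ * (‖y‖ ^ Module.finrank ℝ E)⁻¹))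
      (Metric.ball 0 R) μ := by
    rw [integrableOn_fun_norm_addHaar μ (f := fun r ↦ M * (r * (r ^ Module.finrank ℝ E)⁻¹))]
    refine IntegrableOn.congr_fun (f := fun _ ↦ M) (by simp) (fun r hr ↦ ?_)
      measurableSet_Ioo
    have hr0 : r ≠ 0 := hr.1.ne'
    obtain ⟨k, hk⟩ := Nat.exists_eq_succ_of_ne_zero hn
    simp only [hk, Nat.succ_eq_add_one, Nat.add_sub_cancel, smul_eq_mul]
    field_simp
    ring
  have hsupp : Function.support (fun y ↦ (‖y‖ ^ Module.finrank ℝ E)⁻¹ * fderiv ℝ ψ y y) ⊆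
      Metric.ball 0 R := by
    intro y hy
    apply hR
    apply subset_tsupport
    intro h0
    simp [h0] at hy
  rw [← integrableOn_iff_integrable_of_support_subset hsupp]
  refine hball.mono' ?_ (.of_forall fun y ↦ ?_)
  · refine Measurable.aestronglyMeasurable ?_
    have : Continuous fun y ↦ fderiv ℝ ψ y y := hcont.clm_apply continuous_id
    fun_prop
  · rw [norm_mul, norm_inv, norm_pow, norm_norm]
    have := (fderiv ℝ ψ y).le_of_opNorm_le (hM y) y
    calc (‖y‖ ^ Module.finrank ℝ E)⁻¹ * ‖fderiv ℝ ψ y y‖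
        ≤ (‖y‖ ^ Module.finrank ℝ E)⁻¹ * (M * ‖y‖) := by gcongr
      _ = _ := by ring

/-- At `y = r ω` the Jacobian `r ^ (n - 1)` and the factor `r` from `Dψ(y) y = r Dψ(r ω) ω` absorb
`r ^ (-n)`. What remains along each ray is the derivative of `r ↦ ψ (r ω)`, which integrates to `-ψ
0` whatever `ω` is. -/
theorem integral_radial_fderiv {ψ : E → ℝ} (hψ : ContDiff ℝ 1 ψ) (hc : HasCompactSupport ψ) :
    ∫ y, (‖y‖ ^ Module.finrank ℝ E)⁻¹ * fderiv ℝ ψ y y ∂μ =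
      -(μ.toSphere.real Set.univ * ψ 0) := by
  set n := Module.finrank ℝ E with hn
  set f : E → ℝ := fun y ↦ (‖y‖ ^ n)⁻¹ * fderiv ℝ ψ y y with hf
  set g : Metric.sphere (0 : E) 1 × Set.Ioi (0 : ℝ) → ℝ := fun p ↦ f (p.2.1 • p.1.1) with hg
  have hmp := μ.measurePreserving_homeomorphUnitSphereProd
  have hemb := (homeomorphUnitSphereProd E).measurableEmbedding
  have hgf : ∀ x : ({0}ᶜ : Set E), g (homeomorphUnitSphereProd E x) = f x := by
    intro x
    have hx : ‖(x : E)‖ ≠ 0 := norm_ne_zero_iff.2 x.2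
    simp [hg, smul_smul, hx]
  have hgi : Integrable g (μ.toSphere.prod (.volumeIoiPow (n - 1))) := by
    rw [← hmp.integrable_comp_emb hemb]
    have : Integrable f μ := integrable_radial_fderiv μ hψ hc
    -- The origin is a null set, so it can be removed to match the domain of the polar
    -- homeomorphism.
    rw [← restrict_compl_singleton (μ := μ) 0, ← IntegrableOn,
      integrableOn_iff_comap_subtypeVal (by measurability)] at this
    exact this.congr (.of_forall fun x ↦ (hgf x).symm)
  have hinner : ∀ ω : Metric.sphere (0 : E) 1,
      ∫ r, g (ω, r) ∂(Measure.volumeIoiPow (n - 1)) = -ψ 0 := by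
    intro ω
    have hω : ‖(ω : E)‖ = 1 := by simp
    rw [← integral_Ioi_fderiv_smul hψ hc hω, Measure.volumeIoiPow]
    simp only [ENNReal.ofReal]
    rw [integral_withDensity_eq_integral_smul
        ((measurable_subtype_coe.pow_const _).real_toNNReal),
      integral_subtype_comap measurableSet_Ioi
        fun a : ℝ ↦ Real.toNNReal (a ^ (n - 1)) • f (a • ω.1)]
    refine setIntegral_congr_fun measurableSet_Ioi fun r hr ↦ ?_
    have hr0 : 0 < r := hr
    obtain ⟨k, hk⟩ := Nat.exists_eq_succ_of_ne_zero (Module.finrank_pos (R := ℝ) (M := E)).ne'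
    simp only [NNReal.smul_def, Real.coe_toNNReal _ (pow_nonneg hr0.le _), hf, norm_smul, hω,
      Real.norm_of_nonneg hr0.le, map_smul, smul_eq_mul, hn, hk, Nat.succ_eq_add_one,
      Nat.add_sub_cancel, mul_one]
    field_simp
    ring
  calc ∫ y, f y ∂μ = ∫ x : ({(0)}ᶜ : Set E), f x ∂(μ.comap (↑)) := by
        rw [integral_subtype_comap (measurableSet_singleton _).compl f, restrict_compl_singleton]
    _ = ∫ x : ({(0)}ᶜ : Set E), g (homeomorphUnitSphereProd E x) ∂(μ.comap (↑)) := by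
        simp only [hgf]
    _ = ∫ p, g p ∂(μ.toSphere.prod (.volumeIoiPow (n - 1))) := hmp.integral_comp hemb g
    _ = ∫ ω, ∫ r, g (ω, r) ∂(Measure.volumeIoiPow (n - 1)) ∂μ.toSphere := integral_prod g hgi
    _ = _ := by simp [hinner]

end Radial

/-! ### Affine change of variables taking the quadratic form to the squared norm. -/

open scoped MatrixOrder in
theorem Matrix.PosDef.exists_eq_mul_transpose {ι : Type*} [Fintype ι] [DecidableEq ι]
    {A : Matrix ι ι ℝ} (hA : A.PosDef) : ∃ C : Matrix ι ι ℝ, A = C * Cᵀ := by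
  obtain ⟨X, hX⟩ := CStarAlgebra.nonneg_iff_eq_star_mul_self.1 hA.posSemidef.nonneg
  exact ⟨Xᵀ, by simpa [Matrix.star_eq_conjTranspose,
    Matrix.conjTranspose_eq_transpose_of_trivial] using hX⟩

/-- Take `L = C` with `A = C Cᵀ`: then `Cᵀ (C Cᵀ)⁻¹ C = 1` and `det A = (det C) ^ 2`. -/
theorem exists_linearEquiv_invQuadForm_eq_norm_sq {d : ℕ} {A : Matrix (Fin d) (Fin d) ℝ}
    (hA : A.PosDef) : ∃ L : EuclideanSpace ℝ (Fin d) ≃ₗ[ℝ] EuclideanSpace ℝ (Fin d),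
      (∀ y, invQuadForm A (L y) = ‖y‖ ^ 2) ∧
        |LinearMap.det (L : EuclideanSpace ℝ (Fin d) →ₗ[ℝ] EuclideanSpace ℝ (Fin d))| = √A.det := by
  obtain ⟨C, rfl⟩ := hA.exists_eq_mul_transpose
  have hdet : (C * Cᵀ).det = C.det ^ 2 := by rw [Matrix.det_mul, Matrix.det_transpose, sq]
  have hC : C.det ≠ 0 := by
    intro h
    have := hA.det_pos
    simp [hdet, h] at this
  have hCu : IsUnit C.det := hC.isUnit
  have hCtu : IsUnit Cᵀ.det := by rwa [Matrix.det_transpose]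
  have hL : LinearMap.det (Matrix.toLpLin 2 2 C) ≠ 0 := by rwa [LinearMap.det_toLpLin]
  refine ⟨LinearEquiv.ofIsUnitDet (f := Matrix.toLpLin 2 2 C)
    (v := PiLp.basisFun 2 ℝ (Fin d)) (v' := PiLp.basisFun 2 ℝ (Fin d)) ?_, fun y ↦ ?_, ?_⟩
  · rw [LinearMap.det_toMatrix]
    exact hL.isUnit
  · have h1 : Cᵀ * ((C * Cᵀ)⁻¹ * C) = 1 := by
      rw [Matrix.mul_inv_rev, Matrix.mul_assoc, Matrix.nonsing_inv_mul _ hCu, Matrix.mul_one,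
        Matrix.mul_nonsing_inv _ hCtu]
    rw [invQuadForm]
    simp only [LinearEquiv.ofIsUnitDet_apply, Matrix.ofLp_toLpLin, Matrix.toLin'_apply]
    -- Moving the left factor `C` across the dot product as `Cᵀ` makes the product in `h1` appear.
    nth_rewrite 1 [← Matrix.vecMul_transpose C y.ofLp]
    rw [Matrix.mulVec_mulVec, ← Matrix.dotProduct_mulVec, Matrix.mulVec_mulVec, h1,
      Matrix.one_mulVec, EuclideanSpace.real_norm_sq_eq]
    simp [dotProduct, sq]
  · have : ((LinearEquiv.ofIsUnitDet (f := Matrix.toLpLin 2 2 C)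
      (v := PiLp.basisFun 2 ℝ (Fin d)) (v' := PiLp.basisFun 2 ℝ (Fin d))
      (by rw [LinearMap.det_toMatrix]; exact hL.isUnit) : _ ≃ₗ[ℝ] _) : _ →ₗ[ℝ] _) =
      Matrix.toLpLin 2 2 C := by ext; rfl
    rw [this, LinearMap.det_toLpLin, hdet, Real.sqrt_sq_eq_abs]

section Affine

variable {E : Type*} [NormedAddCommGroup E] [NormedSpace ℝ E] [FiniteDimensional ℝ E]

/-- The affine homeomorphism `y ↦ L y + η`. -/
noncomputable def linearAddConstHomeomorph (L : E ≃ₗ[ℝ] E) (η : E) : E ≃ₜ E :=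
  L.toContinuousLinearEquiv.toHomeomorph.trans (Homeomorph.addRight η)

@[simp]
theorem linearAddConstHomeomorph_apply (L : E ≃ₗ[ℝ] E) (η y : E) :
    linearAddConstHomeomorph L η y = L y + η := rfl

variable [MeasurableSpace E] [BorelSpace E] (μ : Measure E) [μ.IsAddHaarMeasure]

theorem eq_smul_map_linearAddConstHomeomorph (L : E ≃ₗ[ℝ] E) (η : E) :
    μ = ENNReal.ofReal |LinearMap.det (L : E →ₗ[ℝ] E)| • μ.map (linearAddConstHomeomorph L η) := by
  have hL : LinearMap.det (L : E →ₗ[ℝ] E) ≠ 0 := L.isUnit_det'.ne_zero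
  have h1 : μ.map (linearAddConstHomeomorph L η) =
      ENNReal.ofReal |(LinearMap.det (L : E →ₗ[ℝ] E))⁻¹| • μ := by
    have h2 : (linearAddConstHomeomorph L η : E → E) = (· + η) ∘ (L : E →ₗ[ℝ] E) := rfl
    rw [h2, ← Measure.map_map (by fun_prop)
      (L : E →ₗ[ℝ] E).continuous_of_finiteDimensional.measurable,
      Measure.map_linearMap_addHaar_eq_smul_addHaar μ hL, Measure.map_smul,
      map_add_right_eq_self]
  rw [h1, smul_smul, ← ENNReal.ofReal_mul (abs_nonneg _), ← abs_mul, mul_inv_cancel₀ hL]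
  simp

variable {μ}

theorem integrable_of_comp_linearAddConstHomeomorph (L : E ≃ₗ[ℝ] E) (η : E) {f : E → ℝ}
    (hf : Integrable (f ∘ linearAddConstHomeomorph L η) μ) : Integrable f μ := by
  rw [eq_smul_map_linearAddConstHomeomorph μ L η]
  exact ((linearAddConstHomeomorph L η).measurableEmbedding.integrable_map_iff.2 hf).smul_measure
    ENNReal.ofReal_ne_top

theorem locallyIntegrable_of_comp_linearAddConstHomeomorph (L : E ≃ₗ[ℝ] E) (η : E) {f : E → ℝ}
    (hf : LocallyIntegrable (f ∘ linearAddConstHomeomorph L η) μ) : LocallyIntegrable f μ := by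
  intro x
  obtain ⟨U, hU, hi⟩ := (locallyIntegrable_map_homeomorph (linearAddConstHomeomorph L η)).2 hf x
  refine ⟨U, hU, ?_⟩
  rw [eq_smul_map_linearAddConstHomeomorph μ L η, IntegrableOn, Measure.restrict_smul]
  exact hi.smul_measure ENNReal.ofReal_ne_top

theorem integral_eq_abs_det_mul_integral_comp_linearAddConstHomeomorph (L : E ≃ₗ[ℝ] E) (η : E)
    (f : E → ℝ) :
    ∫ x, f x ∂μ = |LinearMap.det (L : E →ₗ[ℝ] E)| * ∫ y, f (L y + η) ∂μ := by
  conv_lhs => rw [eq_smul_map_linearAddConstHomeomorph μ L η]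
  rw [integral_smul_measure, (linearAddConstHomeomorph L η).measurableEmbedding.integral_map,
    ENNReal.toReal_ofReal (abs_nonneg _)]
  rfl

end Affine

/-! ### The radial profile and local integrability. -/

/-- The radial profile of the fundamental solution of the Laplacian, as a function of the square
of the radius and without the factor involving the area of the sphere. -/
noncomputable def greenProfile (d : ℕ) (t : ℝ) : ℝ :=
  if d = 2 then Real.log t / 2 else -(1 / ((d : ℝ) - 2)) * t ^ ((2 - (d : ℝ)) / 2)

/-- The logarithmic and power cases share this derivative, so the later calculus needs no case split
on `d`. -/
theorem hasDerivAt_greenProfile (d : ℕ) {t : ℝ} (ht : 0 < t) :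
    HasDerivAt (greenProfile d) (t ^ (-(d : ℝ) / 2) / 2) t := by
  unfold greenProfile
  split_ifs with h
  · refine ((Real.hasDerivAt_log ht.ne').div_const 2).congr_deriv ?_
    rw [h, show -((2 : ℕ) : ℝ) / 2 = -1 by norm_num, Real.rpow_neg_one]
  · have hd : (d : ℝ) - 2 ≠ 0 := sub_ne_zero.2 (by exact_mod_cast h)
    refine ((Real.hasDerivAt_rpow_const (p := (2 - (d : ℝ)) / 2) (Or.inl ht.ne')).const_mul
      (-(1 / ((d : ℝ) - 2)))).congr_deriv ?_
    rw [show (2 - (d : ℝ)) / 2 - 1 = -(d : ℝ) / 2 by ring]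
    field_simp
    ring

theorem continuousOn_greenProfile (d : ℕ) : ContinuousOn (greenProfile d) (Set.Ioi 0) :=
  fun _ ht ↦ (hasDerivAt_greenProfile d ht).continuousAt.continuousWithinAt

theorem monotoneOn_greenProfile (d : ℕ) : MonotoneOn (greenProfile d) (Set.Ioi 0) := by
  refine monotoneOn_of_deriv_nonneg (convex_Ioi 0) (continuousOn_greenProfile d) ?_ ?_
  · rw [interior_Ioi]
    exact fun t ht ↦ (hasDerivAt_greenProfile d ht).differentiableAt.differentiableWithinAt
  · rw [interior_Ioi]
    intro t ht
    rw [(hasDerivAt_greenProfile d ht).deriv]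
    have : 0 < t := ht
    positivity

/-- Monotonicity traps the value at `t + ε` between those at `t` and `t + 1`. This supplies a
majorant independent of `ε` for dominated convergence. -/
theorem abs_greenProfile_add_le (d : ℕ) {t ε : ℝ} (ht : 0 < t) (hε : 0 ≤ ε) (hε1 : ε ≤ 1) :
    |greenProfile d (t + ε)| ≤ |greenProfile d t| + |greenProfile d (t + 1)| := by
  have h0 : t ∈ Set.Ioi (0 : ℝ) := ht
  have hmem : t + ε ∈ Set.Ioi (0 : ℝ) := by simp only [Set.mem_Ioi]; linarith
  have h1 : t + 1 ∈ Set.Ioi (0 : ℝ) := by simp only [Set.mem_Ioi]; linarith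
  have hl := monotoneOn_greenProfile d h0 hmem (by linarith)
  have hr := monotoneOn_greenProfile d hmem h1 (by linarith)
  rw [abs_le]
  constructor
  · linarith [neg_abs_le (greenProfile d t), abs_nonneg (greenProfile d (t + 1))]
  · linarith [le_abs_self (greenProfile d (t + 1)), abs_nonneg (greenProfile d t)]

/-- The polar Jacobian removes the singularity: both right-hand sides are continuous up to `r = 0`,
which yields local integrability. -/
theorem pow_mul_greenProfile_sq {d : ℕ} (hd : 2 ≤ d) {r : ℝ} (hr : 0 < r) :
    r ^ (d - 1) * greenProfile d (r ^ 2) =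
      if d = 2 then r * Real.log r else -(1 / ((d : ℝ) - 2)) * r := by
  unfold greenProfile
  split_ifs with h
  · subst h
    simp [Real.log_pow]
  · rw [← Real.rpow_natCast r 2, ← Real.rpow_mul hr.le, ← Real.rpow_natCast, mul_left_comm,
      ← Real.rpow_add hr, Nat.cast_sub (by omega)]
    congr 1
    convert Real.rpow_one r using 2
    push_cast
    ring

theorem locallyIntegrable_greenProfile_norm_sq {d : ℕ} (hd : 2 ≤ d) :
    LocallyIntegrable (fun y : EuclideanSpace ℝ (Fin d) ↦ greenProfile d (‖y‖ ^ 2)) := by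
  have : Nonempty (Fin d) := ⟨⟨0, by omega⟩⟩
  have hball (R : ℝ) : IntegrableOn
      (fun y : EuclideanSpace ℝ (Fin d) ↦ greenProfile d (‖y‖ ^ 2)) (Metric.ball 0 R) := by
    rw [integrableOn_fun_norm_addHaar volume (f := fun r ↦ greenProfile d (r ^ 2)),
      finrank_euclideanSpace, Fintype.card_fin]
    have hc : Continuous fun r : ℝ ↦
        if d = 2 then r * Real.log r else -(1 / ((d : ℝ) - 2)) * r := by
      split_ifs
      · exact Real.continuous_mul_log
      · fun_prop
    refine IntegrableOn.congr_fun ((hc.integrableOn_Icc (a := 0) (b := R)).mono_set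
      Set.Ioo_subset_Icc_self) (fun r hr ↦ ?_) measurableSet_Ioo
    exact (pow_mul_greenProfile_sq hd hr.1).symm
  exact fun y ↦ ⟨Metric.ball 0 (‖y‖ + 1), Metric.isOpen_ball.mem_nhds (by simp), hball _⟩

theorem locallyIntegrable_greenProfile_invQuadForm {d : ℕ} (hd : 2 ≤ d)
    {A : Matrix (Fin d) (Fin d) ℝ} (hA : A.PosDef) (η : EuclideanSpace ℝ (Fin d)) :
    LocallyIntegrable (fun ξ ↦ greenProfile d (invQuadForm A (ξ - η))) := by
  obtain ⟨L, hL, -⟩ := exists_linearEquiv_invQuadForm_eq_norm_sq hA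
  refine locallyIntegrable_of_comp_linearAddConstHomeomorph L η ?_
  simpa [Function.comp_def, hL] using locallyIntegrable_greenProfile_norm_sq hd

theorem invQuadForm_pos {d : ℕ} {A : Matrix (Fin d) (Fin d) ℝ} (hA : A.PosDef)
    {v : EuclideanSpace ℝ (Fin d)} (hv : v ≠ 0) : 0 < invQuadForm A v := by
  obtain ⟨L, hL, -⟩ := exists_linearEquiv_invQuadForm_eq_norm_sq hA
  obtain ⟨y, rfl⟩ := L.surjective v
  rw [hL]
  have : y ≠ 0 := by rintro rfl; simp at hv
  positivity

theorem invQuadForm_nonneg {d : ℕ} {A : Matrix (Fin d) (Fin d) ℝ} (hA : A.PosDef)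
    (v : EuclideanSpace ℝ (Fin d)) : 0 ≤ invQuadForm A v := by
  rcases eq_or_ne v 0 with rfl | hv
  · simp [invQuadForm]
  · exact (invQuadForm_pos hA hv).le

/-- For `d = 2` this uses `ω_2 = 2π` and `log √t = log t / 2`. -/
theorem anisotropicGreen_eq {d : ℕ} {A : Matrix (Fin d) (Fin d) ℝ} (hA : A.PosDef)
    (ξ η : EuclideanSpace ℝ (Fin d)) :
    anisotropicGreen A ξ η =
      (unitSphereArea d * √A.det)⁻¹ * greenProfile d (invQuadForm A (ξ - η)) := by
  unfold anisotropicGreen greenProfile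
  split_ifs with h
  · subst h
    rw [unitSphereArea_eq le_rfl, Real.log_sqrt (invQuadForm_nonneg hA _)]
    simp
  · rw [mul_assoc, one_div, one_div, mul_inv ((d : ℝ) - 2)]
    ring

/-! ### The radial identity for the quadratic form. -/

section RadialQuadForm

variable {d : ℕ} {A : Matrix (Fin d) (Fin d) ℝ} {φ : EuclideanSpace ℝ (Fin d) → ℝ}

theorem rpow_mul_fderiv_comp_linearAddConstHomeomorph
    {L : EuclideanSpace ℝ (Fin d) ≃ₗ[ℝ] EuclideanSpace ℝ (Fin d)}
    (hL : ∀ y, invQuadForm A (L y) = ‖y‖ ^ 2) (hφ : Differentiable ℝ φ)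
    (η y : EuclideanSpace ℝ (Fin d)) :
    invQuadForm A (L y + η - η) ^ (-(d : ℝ) / 2) * fderiv ℝ φ (L y + η) (L y + η - η) =
      (‖y‖ ^ d)⁻¹ * fderiv ℝ (φ ∘ linearAddConstHomeomorph L η) y y := by
  have h1 : HasFDerivAt (linearAddConstHomeomorph L η) 
      (L.toContinuousLinearEquiv : EuclideanSpace ℝ (Fin d) →L[ℝ] EuclideanSpace ℝ (Fin d)) y :=
    L.toContinuousLinearEquiv.hasFDerivAt.add_const η
  rw [((hφ (linearAddConstHomeomorph L η y)).hasFDerivAt.comp y h1).fderiv,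
    add_sub_cancel_right, hL, ← Real.rpow_natCast, ← Real.rpow_mul (norm_nonneg _), ← Real.rpow_natCast,
    ← Real.rpow_neg (norm_nonneg _)]
  congr 2
  push_cast
  ring

theorem contDiff_comp_linearAddConstHomeomorph (hφ : ContDiff ℝ 1 φ)
    (L : EuclideanSpace ℝ (Fin d) ≃ₗ[ℝ] EuclideanSpace ℝ (Fin d)) (η : EuclideanSpace ℝ (Fin d)) :
    ContDiff ℝ 1 (φ ∘ linearAddConstHomeomorph L η) :=
  hφ.comp (L.toContinuousLinearEquiv.contDiff.add contDiff_const)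

theorem integrable_invQuadForm_rpow_mul_fderiv (hd : 2 ≤ d) (hA : A.PosDef)
    (hφ : ContDiff ℝ 1 φ) (hc : HasCompactSupport φ) (η : EuclideanSpace ℝ (Fin d)) :
    Integrable fun ξ ↦ invQuadForm A (ξ - η) ^ (-(d : ℝ) / 2) * fderiv ℝ φ ξ (ξ - η) := by
  have : Nonempty (Fin d) := ⟨⟨0, by omega⟩⟩
  obtain ⟨L, hL, -⟩ := exists_linearEquiv_invQuadForm_eq_norm_sq hA
  refine integrable_of_comp_linearAddConstHomeomorph L η ?_
  have := integrable_radial_fderiv volume (contDiff_comp_linearAddConstHomeomorph hφ L η)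
    (hc.comp_homeomorph _)
  rw [finrank_euclideanSpace, Fintype.card_fin] at this
  refine this.congr (.of_forall fun y ↦ ?_)
  exact (rpow_mul_fderiv_comp_linearAddConstHomeomorph hL (hφ.differentiable one_ne_zero) η y).symm

theorem integral_invQuadForm_rpow_mul_fderiv (hd : 2 ≤ d) (hA : A.PosDef)
    (hφ : ContDiff ℝ 1 φ) (hc : HasCompactSupport φ) (η : EuclideanSpace ℝ (Fin d)) :
    ∫ ξ, invQuadForm A (ξ - η) ^ (-(d : ℝ) / 2) * fderiv ℝ φ ξ (ξ - η) =
      -(unitSphereArea d * √A.det * φ η) := by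
  have : Nonempty (Fin d) := ⟨⟨0, by omega⟩⟩
  obtain ⟨L, hL, hdet⟩ := exists_linearEquiv_invQuadForm_eq_norm_sq hA
  have := integral_radial_fderiv volume (contDiff_comp_linearAddConstHomeomorph hφ L η)
    (hc.comp_homeomorph _)
  rw [finrank_euclideanSpace, Fintype.card_fin] at this
  rw [integral_eq_abs_det_mul_integral_comp_linearAddConstHomeomorph L η]
  simp only [rpow_mul_fderiv_comp_linearAddConstHomeomorph hL (hφ.differentiable one_ne_zero) η]
  rw [this, hdet, unitSphereArea]
  simp only [Function.comp_apply, linearAddConstHomeomorph_apply, map_zero, zero_add]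
  ring

end RadialQuadForm

/-! ### Differential calculus of the quadratic form. -/

section QuadForm

variable {d : ℕ} {A : Matrix (Fin d) (Fin d) ℝ}

theorem invQuadForm_eq_inner (A : Matrix (Fin d) (Fin d) ℝ) (v : EuclideanSpace ℝ (Fin d)) :
    invQuadForm A v = inner ℝ v ((Matrix.toLpLin 2 2 A⁻¹).toContinuousLinearMap v) := by
  simp [invQuadForm, EuclideanSpace.inner_eq_star_dotProduct, dotProduct_comm]

theorem differentiable_invQuadForm (A : Matrix (Fin d) (Fin d) ℝ) :
    Differentiable ℝ (invQuadForm A) := by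
  rw [funext (invQuadForm_eq_inner A)]
  exact differentiable_id.inner ℝ (ContinuousLinearMap.differentiable _)

theorem fderiv_invQuadForm (hA : A.PosDef) (v w : EuclideanSpace ℝ (Fin d)) :
    fderiv ℝ (invQuadForm A) v w = 2 * (w.ofLp ⬝ᵥ (A⁻¹ *ᵥ v.ofLp)) := by
  rw [funext (invQuadForm_eq_inner A), fderiv_inner_apply ℝ differentiableAt_fun_id
    (ContinuousLinearMap.differentiableAt _), ContinuousLinearMap.fderiv]
  have hs : (A⁻¹)ᵀ = A⁻¹ := by
    rw [Matrix.transpose_nonsing_inv]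
    congr 1
    simpa [Matrix.conjTranspose_eq_transpose_of_trivial] using hA.isHermitian.eq
  have : v.ofLp ⬝ᵥ (A⁻¹ *ᵥ w.ofLp) = w.ofLp ⬝ᵥ (A⁻¹ *ᵥ v.ofLp) := by
    rw [Matrix.dotProduct_mulVec, ← Matrix.mulVec_transpose, hs, dotProduct_comm]
  simp [EuclideanSpace.inner_eq_star_dotProduct, dotProduct_comm _ v.ofLp,
    dotProduct_comm _ w.ofLp, this]
  ring

theorem hasFDerivAt_greenProfile_invQuadForm (hA : A.PosDef) (η ξ : EuclideanSpace ℝ (Fin d))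
    {ε : ℝ} (hε : 0 < ε) :
    HasFDerivAt (fun x ↦ greenProfile d (invQuadForm A (x - η) + ε))
      (((invQuadForm A (ξ - η) + ε) ^ (-(d : ℝ) / 2) / 2) • fderiv ℝ (invQuadForm A) (ξ - η)) ξ := by
  have h1 : HasFDerivAt (fun x ↦ invQuadForm A (x - η) + ε)
      (fderiv ℝ (invQuadForm A) (ξ - η)) ξ := by
    have := (differentiable_invQuadForm A (ξ - η)).hasFDerivAt.comp ξ
      ((hasFDerivAt_id ξ).sub_const η)
    exact this.add_const ε
  exact (hasDerivAt_greenProfile d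
    (add_pos_of_nonneg_of_pos (invQuadForm_nonneg hA (ξ - η)) hε)).comp_hasFDerivAt ξ h1

theorem fderiv_greenProfile_invQuadForm (hA : A.PosDef) (η ξ w : EuclideanSpace ℝ (Fin d))
    {ε : ℝ} (hε : 0 < ε) :
    fderiv ℝ (fun x ↦ greenProfile d (invQuadForm A (x - η) + ε)) ξ w =
      (invQuadForm A (ξ - η) + ε) ^ (-(d : ℝ) / 2) * (w.ofLp ⬝ᵥ (A⁻¹ *ᵥ (ξ - η).ofLp)) := by
  rw [(hasFDerivAt_greenProfile_invQuadForm hA η ξ hε).fderiv, _root_.smul_apply,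
    fderiv_invQuadForm hA, smul_eq_mul]
  ring

/-- This is `A A⁻¹ v = v` paired with `ℓ`. It is how `A∇q = 2(ξ - η)` collapses the double sum left
by the integration by parts. -/
theorem sum_mul_inv_mulVec_mul_apply_single (hA : A.PosDef) (v : EuclideanSpace ℝ (Fin d))
    (ℓ : EuclideanSpace ℝ (Fin d) →L[ℝ] ℝ) :
    ∑ i, ∑ j, A i j * ((A⁻¹ *ᵥ v.ofLp) j * ℓ (EuclideanSpace.single i 1)) = ℓ v := by
  have hdet : IsUnit A.det := hA.det_pos.ne'.isUnit
  have h1 : A *ᵥ (A⁻¹ *ᵥ v.ofLp) = v.ofLp := by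
    rw [Matrix.mulVec_mulVec, Matrix.mul_nonsing_inv _ hdet, Matrix.one_mulVec]
  have h2 : v = ∑ i, v i • EuclideanSpace.single i (1 : ℝ) := by
    simpa using ((EuclideanSpace.basisFun (Fin d) ℝ).sum_repr v).symm
  conv_rhs => rw [h2, map_sum]
  refine Finset.sum_congr rfl fun i _ ↦ ?_
  rw [map_smul, smul_eq_mul, ← congrFun h1 i]
  simp only [Matrix.mulVec, dotProduct, Finset.sum_mul, mul_assoc]

/-- Makes the conventional values of `log` and `rpow` at the pole irrelevant to the integrals. -/
theorem ae_invQuadForm_sub_pos (hd : 2 ≤ d) (hA : A.PosDef) (η : EuclideanSpace ℝ (Fin d)) :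
    ∀ᵐ ξ, 0 < invQuadForm A (ξ - η) := by
  have : Nonempty (Fin d) := ⟨⟨0, by omega⟩⟩
  filter_upwards [compl_mem_ae_iff.2 (measure_singleton η)] with ξ hξ
  exact invQuadForm_pos hA (sub_ne_zero.2 hξ)

end QuadForm

/-! ### Regularized integration by parts and the limit. -/

section Green

variable {d : ℕ} {A : Matrix (Fin d) (Fin d) ℝ} {φ : EuclideanSpace ℝ (Fin d) → ℝ}

/-- The function `∇·(A∇φ) = ∑ᵢ ∑ⱼ Aᵢⱼ ∂ⱼ ∂ᵢ φ`. -/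
noncomputable def divGrad (A : Matrix (Fin d) (Fin d) ℝ) (φ : EuclideanSpace ℝ (Fin d) → ℝ)
    (ξ : EuclideanSpace ℝ (Fin d)) : ℝ :=
  ∑ i, ∑ j, A i j * fderiv ℝ (fun x ↦ fderiv ℝ φ x (EuclideanSpace.single i 1)) ξ
    (EuclideanSpace.single j 1)

theorem contDiff_fderiv_apply (hφ : ContDiff ℝ 2 φ) (w : EuclideanSpace ℝ (Fin d)) :
    ContDiff ℝ 1 fun x ↦ fderiv ℝ φ x w :=
  (hφ.fderiv_right (m := 1) (by norm_num)).clm_apply contDiff_const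

theorem continuous_fderiv_fderiv_apply (hφ : ContDiff ℝ 2 φ)
    (w w' : EuclideanSpace ℝ (Fin d)) :
    Continuous fun ξ ↦ fderiv ℝ (fun x ↦ fderiv ℝ φ x w) ξ w' :=
  ((contDiff_fderiv_apply hφ w).continuous_fderiv one_ne_zero).clm_apply continuous_const

theorem hasCompactSupport_fderiv_fderiv_apply (hc : HasCompactSupport φ)
    (w w' : EuclideanSpace ℝ (Fin d)) :
    HasCompactSupport fun ξ ↦ fderiv ℝ (fun x ↦ fderiv ℝ φ x w) ξ w' :=
  (hc.fderiv_apply ℝ w).fderiv_apply ℝ w'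

theorem continuous_divGrad (A : Matrix (Fin d) (Fin d) ℝ) (hφ : ContDiff ℝ 2 φ) :
    Continuous (divGrad A φ) :=
  continuous_finsetSum _ fun _ _ ↦ continuous_finsetSum _ fun _ _ ↦
    continuous_const.mul (continuous_fderiv_fderiv_apply hφ _ _)

theorem hasCompactSupport_divGrad (A : Matrix (Fin d) (Fin d) ℝ) (hc : HasCompactSupport φ) :
    HasCompactSupport (divGrad A φ) := by
  refine HasCompactSupport.of_support_subset_isCompact hc.isCompact fun ξ hξ ↦ ?_
  by_contra h
  refine hξ (Finset.sum_eq_zero fun i _ ↦ Finset.sum_eq_zero fun j _ ↦ ?_)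
  have h1 := tsupport_fderiv_apply_subset ℝ (f := φ) (EuclideanSpace.single i (1 : ℝ))
  have h2 := tsupport_fderiv_apply_subset ℝ
    (f := fun x ↦ fderiv ℝ φ x (EuclideanSpace.single i (1 : ℝ))) (EuclideanSpace.single j (1 : ℝ))
  rw [image_eq_zero_of_notMem_tsupport (fun h3 ↦ h (h1 (h2 h3))), mul_zero]

theorem integral_sum_sum_const_mul {α ι κ : Type*} [Fintype ι] [Fintype κ] [MeasurableSpace α]
    {μ : Measure α} (c : ι → κ → ℝ) {f : ι → κ → α → ℝ} (hf : ∀ i j, Integrable (f i j) μ) :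
    ∫ x, ∑ i, ∑ j, c i j * f i j x ∂μ = ∑ i, ∑ j, c i j * ∫ x, f i j x ∂μ := by
  rw [integral_finsetSum _ fun i _ ↦ integrable_finsetSum _ fun j _ ↦ (hf i j).const_mul _]
  refine Finset.sum_congr rfl fun i _ ↦ ?_
  rw [integral_finsetSum _ fun j _ ↦ (hf i j).const_mul _]
  simp only [integral_const_mul]

/-- With `ε > 0` the argument of the profile stays positive, so the pole disappears, and the compact
support of `φ` kills all boundary terms. -/
theorem integral_greenProfile_add_mul_divGrad (hA : A.PosDef) (hφ : ContDiff ℝ 2 φ)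
    (hc : HasCompactSupport φ) (η : EuclideanSpace ℝ (Fin d)) {ε : ℝ} (hε : 0 < ε) :
    ∫ ξ, greenProfile d (invQuadForm A (ξ - η) + ε) * divGrad A φ ξ =
      -∫ ξ, (invQuadForm A (ξ - η) + ε) ^ (-(d : ℝ) / 2) * fderiv ℝ φ ξ (ξ - η) := by
  set e : Fin d → EuclideanSpace ℝ (Fin d) := fun i ↦ EuclideanSpace.single i 1 with he
  set u : EuclideanSpace ℝ (Fin d) → ℝ :=
    fun ξ ↦ greenProfile d (invQuadForm A (ξ - η) + ε) with hu
  have hpos (ξ) : 0 < invQuadForm A (ξ - η) + ε :=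
    add_pos_of_nonneg_of_pos (invQuadForm_nonneg hA (ξ - η)) hε
  have hud : Differentiable ℝ u := fun ξ ↦
    (hasFDerivAt_greenProfile_invQuadForm hA η ξ hε).differentiableAt
  have hqc : Continuous fun ξ ↦ invQuadForm A (ξ - η) :=
    (differentiable_invQuadForm A).continuous.comp (continuous_id.sub continuous_const)
  have hrc : Continuous fun ξ ↦ (invQuadForm A (ξ - η) + ε) ^ (-(d : ℝ) / 2) :=
    (hqc.add continuous_const).rpow_const fun ξ ↦ Or.inl (hpos ξ).ne'
  have huc (j) : Continuous fun ξ ↦ fderiv ℝ u ξ (e j) := by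
    simp only [hu, fderiv_greenProfile_invQuadForm hA η _ _ hε]
    refine hrc.mul (continuous_const.dotProduct (continuous_const.matrix_mulVec ?_))
    exact (PiLp.continuous_ofLp 2 _).comp (continuous_id.sub continuous_const)
  have hgc (i) : Continuous fun ξ ↦ fderiv ℝ φ ξ (e i) :=
    (contDiff_fderiv_apply hφ (e i)).continuous
  have hi1 (i j) : Integrable fun ξ ↦ u ξ * fderiv ℝ (fun x ↦ fderiv ℝ φ x (e i)) ξ (e j) :=
    (hud.continuous.mul (continuous_fderiv_fderiv_apply hφ _ _)).integrable_of_hasCompactSupport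
      (hasCompactSupport_fderiv_fderiv_apply hc _ _).mul_left
  have hi2 (i j) : Integrable fun ξ ↦ fderiv ℝ u ξ (e j) * fderiv ℝ φ ξ (e i) :=
    ((huc j).mul (hgc i)).integrable_of_hasCompactSupport (hc.fderiv_apply ℝ _).mul_left
  have hi3 (i) : Integrable fun ξ ↦ u ξ * fderiv ℝ φ ξ (e i) :=
    (hud.continuous.mul (hgc i)).integrable_of_hasCompactSupport (hc.fderiv_apply ℝ _).mul_left
  calc ∫ ξ, u ξ * divGrad A φ ξ
      = ∫ ξ, ∑ i, ∑ j, A i j * (u ξ * fderiv ℝ (fun x ↦ fderiv ℝ φ x (e i)) ξ (e j)) := by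
        simp only [divGrad, Finset.mul_sum, he, mul_left_comm]
    _ = ∑ i, ∑ j, A i j * ∫ ξ, u ξ * fderiv ℝ (fun x ↦ fderiv ℝ φ x (e i)) ξ (e j) := by
        exact integral_sum_sum_const_mul (fun i j ↦ A i j) hi1
    _ = ∑ i, ∑ j, A i j * -∫ ξ, fderiv ℝ u ξ (e j) * fderiv ℝ φ ξ (e i) := by
        refine Finset.sum_congr rfl fun i _ ↦ Finset.sum_congr rfl fun j _ ↦ ?_
        rw [integral_mul_fderiv_eq_neg_fderiv_mul_of_integrable (hi2 i j) (hi1 i j) (hi3 i)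
          (fun ξ _ ↦ hud ξ) fun ξ _ ↦ (contDiff_fderiv_apply hφ (e i)).differentiable one_ne_zero ξ]
    _ = -∫ ξ, ∑ i, ∑ j, A i j * (fderiv ℝ u ξ (e j) * fderiv ℝ φ ξ (e i)) := by
        simp only [mul_neg, Finset.sum_neg_distrib]
        exact congrArg Neg.neg (integral_sum_sum_const_mul (fun i j ↦ A i j) hi2).symm
    _ = _ := by
        congr 2
        funext ξ
        rw [← sum_mul_inv_mulVec_mul_apply_single hA (ξ - η) (fderiv ℝ φ ξ), Finset.mul_sum]
        refine Finset.sum_congr rfl fun i _ ↦ ?_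
        rw [Finset.mul_sum]
        refine Finset.sum_congr rfl fun j _ ↦ ?_
        rw [hu, fderiv_greenProfile_invQuadForm hA η ξ _ hε]
        simp only [he, PiLp.ofLp_single, single_dotProduct, one_mul]
        ring

theorem integral_greenProfile_mul_divGrad (hd : 2 ≤ d) (hA : A.PosDef) (hφ : ContDiff ℝ 2 φ)
    (hc : HasCompactSupport φ) (η : EuclideanSpace ℝ (Fin d)) :
    ∫ ξ, greenProfile d (invQuadForm A (ξ - η)) * divGrad A φ ξ =
      unitSphereArea d * √A.det * φ η := by
  have hφ1 : ContDiff ℝ 1 φ := hφ.of_le (by norm_num)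
  have hε (n : ℕ) : (0 : ℝ) < 1 / ((n : ℝ) + 1) := Nat.one_div_pos_of_nat
  -- The regularization is `ε = 1 / (n + 1)`; the bound by `1` is what `abs_greenProfile_add_le`
  -- requires.
  have hε1 (n : ℕ) : 1 / ((n : ℝ) + 1) ≤ 1 := by
    rw [div_le_one (by positivity)]
    linarith [n.cast_nonneg (α := ℝ)]
  have hqc : Continuous fun ξ ↦ invQuadForm A (ξ - η) :=
    (differentiable_invQuadForm A).continuous.comp (continuous_id.sub continuous_const)
  have hpos {ε : ℝ} (h : 0 < ε) (ξ) : 0 < invQuadForm A (ξ - η) + ε :=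
    add_pos_of_nonneg_of_pos (invQuadForm_nonneg hA (ξ - η)) h
  have hgc {ε : ℝ} (h : 0 < ε) :
      Continuous fun ξ ↦ greenProfile d (invQuadForm A (ξ - η) + ε) :=
    (continuousOn_greenProfile d).comp_continuous (hqc.add continuous_const) (hpos h)
  have hrc {ε : ℝ} (h : 0 < ε) :
      Continuous fun ξ ↦ (invQuadForm A (ξ - η) + ε) ^ (-(d : ℝ) / 2) :=
    (hqc.add continuous_const).rpow_const fun ξ ↦ Or.inl (hpos h ξ).ne'
  have hlim (ξ) : Filter.Tendsto (fun n : ℕ ↦ invQuadForm A (ξ - η) + 1 / ((n : ℝ) + 1))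
      Filter.atTop (nhds (invQuadForm A (ξ - η))) := by
    simpa using (tendsto_one_div_add_atTop_nhds_zero_nat (𝕜 := ℝ)).const_add
      (invQuadForm A (ξ - η))
  have hl : Filter.Tendsto (fun n : ℕ ↦ ∫ ξ,
      greenProfile d (invQuadForm A (ξ - η) + 1 / ((n : ℝ) + 1)) * divGrad A φ ξ) Filter.atTop
      (nhds (∫ ξ, greenProfile d (invQuadForm A (ξ - η)) * divGrad A φ ξ)) := by
    refine tendsto_integral_of_dominated_convergence
      (fun ξ ↦ (|greenProfile d (invQuadForm A (ξ - η))| +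
        |greenProfile d (invQuadForm A (ξ - η) + 1)|) * |divGrad A φ ξ|)
      (fun n ↦ ((hgc (hε n)).mul (continuous_divGrad A hφ)).aestronglyMeasurable) ?_
      (fun n ↦ ?_) ?_
    · simp only [add_mul, ← abs_mul]
      exact ((locallyIntegrable_greenProfile_invQuadForm hd hA
        η).integrable_smul_right_of_hasCompactSupport (continuous_divGrad A hφ)
        (hasCompactSupport_divGrad A hc)).abs.add
        (((hgc one_pos).mul (continuous_divGrad A hφ)).integrable_of_hasCompactSupport
        (hasCompactSupport_divGrad A hc).mul_left).abs
    · filter_upwards [ae_invQuadForm_sub_pos hd hA η] with ξ hξ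
      rw [norm_mul, Real.norm_eq_abs, Real.norm_eq_abs]
      gcongr
      exact abs_greenProfile_add_le d hξ (hε n).le (hε1 n)
    · filter_upwards [ae_invQuadForm_sub_pos hd hA η] with ξ hξ
      exact ((hasDerivAt_greenProfile d hξ).continuousAt.tendsto.comp (hlim ξ)).mul_const _
  have hr : Filter.Tendsto (fun n : ℕ ↦ ∫ ξ,
      (invQuadForm A (ξ - η) + 1 / ((n : ℝ) + 1)) ^ (-(d : ℝ) / 2) * fderiv ℝ φ ξ (ξ - η))
      Filter.atTop
      (nhds (∫ ξ, invQuadForm A (ξ - η) ^ (-(d : ℝ) / 2) * fderiv ℝ φ ξ (ξ - η))) := by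
    refine tendsto_integral_of_dominated_convergence
      (fun ξ ↦ |invQuadForm A (ξ - η) ^ (-(d : ℝ) / 2) * fderiv ℝ φ ξ (ξ - η)|)
      (fun n ↦ ((hrc (hε n)).mul ((hφ1.continuous_fderiv one_ne_zero).clm_apply
        (continuous_id.sub continuous_const))).aestronglyMeasurable)
      (integrable_invQuadForm_rpow_mul_fderiv hd hA hφ1 hc η).abs (fun n ↦ ?_) ?_
    · filter_upwards [ae_invQuadForm_sub_pos hd hA η] with ξ hξ
      rw [Real.norm_eq_abs, abs_mul, abs_mul, abs_of_pos (Real.rpow_pos_of_pos hξ _),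
        abs_of_pos (Real.rpow_pos_of_pos (hpos (hε n) ξ) _)]
      gcongr ?_ * _
      -- The exponent is nonpositive, so adding `ε` only decreases the power: the limit integrand
      -- itself is the majorant.
      refine Real.rpow_le_rpow_of_nonpos hξ (by linarith [hε n]) ?_
      have : (0 : ℝ) ≤ d := d.cast_nonneg
      linarith
    · filter_upwards [ae_invQuadForm_sub_pos hd hA η] with ξ hξ
      exact ((hlim ξ).rpow_const (Or.inl hξ.ne')).mul_const _
  have hl' := hl.congr fun n ↦ integral_greenProfile_add_mul_divGrad hA hφ hc η (hε n)
  rw [tendsto_nhds_unique hl' hr.neg, integral_invQuadForm_rpow_mul_fderiv hd hA hφ1 hc η, neg_neg]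

end Green

/-! ### Passage to distributions. -/

theorem TestFunction.lineDerivOp_apply_eq_fderiv {d : ℕ}
    (φ : 𝓓((⊤ : TopologicalSpace.Opens (EuclideanSpace ℝ (Fin d))), ℝ))
    (w x : EuclideanSpace ℝ (Fin d)) : (∂_{w} φ) x = fderiv ℝ φ x w := by
  rw [TestFunction.lineDerivOp_eq_lineDerivCLM ℝ, TestFunction.lineDerivCLM_eq_fderivCLM,
    TestFunction.fderivCLM_apply_of_le _ (by simp)]

theorem TestFunction.lineDerivOp_lineDerivOp_apply_eq_fderiv {d : ℕ}
    (φ : 𝓓((⊤ : TopologicalSpace.Opens (EuclideanSpace ℝ (Fin d))), ℝ))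
    (w w' x : EuclideanSpace ℝ (Fin d)) :
    (∂_{w'} (∂_{w} φ)) x = fderiv ℝ (fun y ↦ fderiv ℝ φ y w) x w' := by
  rw [TestFunction.lineDerivOp_apply_eq_fderiv]
  congr 2

theorem regularDistribution_apply {d : ℕ} {f : EuclideanSpace ℝ (Fin d) → ℝ}
    (hf : LocallyIntegrable f)
    (φ : 𝓓((⊤ : TopologicalSpace.Opens (EuclideanSpace ℝ (Fin d))), ℝ)) :
    regularDistribution f φ = ∫ x, φ x * f x :=
  TestFunction.integralAgainstBilinCLM_eq_integral (hf.locallyIntegrableOn _)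

/-- Each of the two distributional derivatives passes to the test function with a minus sign, and
the signs cancel. -/
theorem anisotropicLaplacian_apply {d : ℕ} (A : Matrix (Fin d) (Fin d) ℝ)
    (T : 𝓓'((⊤ : TopologicalSpace.Opens (EuclideanSpace ℝ (Fin d))), ℝ))
    (φ : 𝓓((⊤ : TopologicalSpace.Opens (EuclideanSpace ℝ (Fin d))), ℝ)) :
    anisotropicLaplacian A T φ = T (∑ i, ∑ j, A i j •
      ∂_{EuclideanSpace.single j (1 : ℝ)} (∂_{EuclideanSpace.single i (1 : ℝ)} φ)) := by
  rw [anisotropicLaplacian]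
  trans ∑ i : Fin d, (∂_{EuclideanSpace.single i (1 : ℝ)}
    (∑ j : Fin d, A i j • ∂_{EuclideanSpace.single j (1 : ℝ)} T)) φ
  · exact map_sum (AddMonoidHom.mk' (fun S : 𝓓'((⊤ : TopologicalSpace.Opens
      (EuclideanSpace ℝ (Fin d))), ℝ) ↦ S φ) fun _ _ ↦ rfl) _ _
  rw [map_sum]
  refine Finset.sum_congr rfl fun i _ ↦ ?_
  rw [Distribution.lineDerivOp_apply_apply]
  trans ∑ j : Fin d, (A i j • ∂_{EuclideanSpace.single j (1 : ℝ)} T)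
    (-∂_{EuclideanSpace.single i (1 : ℝ)} φ)
  · exact map_sum (AddMonoidHom.mk' (fun S : 𝓓'((⊤ : TopologicalSpace.Opens
      (EuclideanSpace ℝ (Fin d))), ℝ) ↦ S (-∂_{EuclideanSpace.single i (1 : ℝ)} φ))
      fun _ _ ↦ rfl) _ _
  rw [map_sum]
  refine Finset.sum_congr rfl fun j _ ↦ ?_
  trans A i j • (∂_{EuclideanSpace.single j (1 : ℝ)} T) (-∂_{EuclideanSpace.single i (1 : ℝ)} φ)
  · rfl
  rw [Distribution.lineDerivOp_apply_apply, LineDeriv.lineDerivOp_neg, neg_neg, map_smul]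

theorem TestFunction.sum_sum_smul_lineDerivOp_apply {d : ℕ} (A : Matrix (Fin d) (Fin d) ℝ)
    (φ : 𝓓((⊤ : TopologicalSpace.Opens (EuclideanSpace ℝ (Fin d))), ℝ))
    (ξ : EuclideanSpace ℝ (Fin d)) :
    (∑ i, ∑ j, A i j • ∂_{EuclideanSpace.single j (1 : ℝ)}
      (∂_{EuclideanSpace.single i (1 : ℝ)} φ)) ξ = divGrad A φ ξ := by
  let ev : 𝓓((⊤ : TopologicalSpace.Opens (EuclideanSpace ℝ (Fin d))), ℝ) →+ ℝ :=
    AddMonoidHom.mk' (fun f ↦ f ξ) fun _ _ ↦ rfl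
  change ev _ = _
  simp only [map_sum, divGrad]
  refine Finset.sum_congr rfl fun i _ ↦ Finset.sum_congr rfl fun j _ ↦ ?_
  rw [← TestFunction.lineDerivOp_lineDerivOp_apply_eq_fderiv]
  rfl

theorem theorem1 (d : ℕ) (hd : 2 ≤ d) (A : Matrix (Fin d) (Fin d) ℝ) (hA : A.PosDef) :
    unitSphereArea d = 2 * Real.pi ^ ((d : ℝ) / 2) / Real.Gamma ((d : ℝ) / 2) ∧
    ∀ η : EuclideanSpace ℝ (Fin d),
      LocallyIntegrable (fun ξ => anisotropicGreen A ξ η) volume ∧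
      anisotropicLaplacian A (regularDistribution (fun ξ => anisotropicGreen A ξ η)) =
        Distribution.delta η := by
  refine ⟨unitSphereArea_eq hd, fun η ↦ ?_⟩
  have hint : LocallyIntegrable (fun ξ ↦ anisotropicGreen A ξ η) volume := by
    simp only [anisotropicGreen_eq hA]
    exact (locallyIntegrable_greenProfile_invQuadForm hd hA η).smul
      (unitSphereArea d * √A.det)⁻¹
  refine ⟨hint, ?_⟩
  ext φ
  have hω : 0 < unitSphereArea d := by
    rw [unitSphereArea_eq hd]
    have : 0 < Real.Gamma ((d : ℝ) / 2) :=
      Real.Gamma_pos_of_pos (half_pos (by exact_mod_cast (by omega : 0 < d)))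
    positivity
  have hdet : 0 < √A.det := Real.sqrt_pos.2 hA.det_pos
  have h := integral_greenProfile_mul_divGrad hd hA (φ := φ)
    (φ.contDiff.of_le (by norm_cast)) φ.hasCompactSupport η
  rw [anisotropicLaplacian_apply, regularDistribution_apply hint, Distribution.delta_apply]
  calc _ = ∫ ξ, (unitSphereArea d * √A.det)⁻¹ *
        (greenProfile d (invQuadForm A (ξ - η)) * divGrad A φ ξ) := by
        congr 1
        funext ξ
        rw [TestFunction.sum_sum_smul_lineDerivOp_apply, anisotropicGreen_eq hA]
        ring
    _ = φ η := by
        rw [integral_const_mul, h]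
        field_simp
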